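/- Let $k$ be a field of characteristic $0$, let $R = k[x_1,\dots,x_r]$ with its standard grading, and let $Q_1,\dots,Q_r \in R$ be forms of degree $2$ that form a regular sequence, so that for $I = (Q_1,\dots,Q_r)$ the graded algebra $R/I$ is an artinian complete intersection. Assume that the socle degree of $R/I$, i.e. the largest $e$ with $[R/I]_e \neq 0$, is at least $3$ (equivalently, $r \geq 3$). Then for a general linear form $L = a_1x_1 + \dots + a_rx_r$, that is, for all coefficient vectors $(a_1,\dots,a_r)$ in some nonempty Zariski open subset of $k^r$, the multiplication map \[ \times L : [R/I]_1 \longrightarrow [R/I]_2 \] is injective. -/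

import Mathlib

namespace QuadricCI

noncomputable section

/-- The degree `d` component `[R/I]_d` of `R/I`, where `R = K[x_1, …, x_r]`: the image in `R/I` of
the space of forms of degree `d`. (It is meant for homogeneous ideals `I`.) -/
def gradedPiece {K : Type*} [Field K] {r : ℕ} (I : Ideal (MvPolynomial (Fin r) K)) (d : ℕ) :
    Submodule K (MvPolynomial (Fin r) K ⧸ I) :=
  (MvPolynomial.homogeneousSubmodule (Fin r) K d).map (Ideal.Quotient.mkₐ K I).toLinearMap

theorem mul_mem_gradedPiece {K : Type*} [Field K] {r : ℕ} (I : Ideal (MvPolynomial (Fin r) K))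
    (L : MvPolynomial.homogeneousSubmodule (Fin r) K 1) (d : ℕ)
    (x : MvPolynomial (Fin r) K ⧸ I) (hx : x ∈ gradedPiece I d) :
    LinearMap.mulLeft K (Ideal.Quotient.mk I L.1) x ∈ gradedPiece I (d + 1) := by
  obtain ⟨p, hp, rfl⟩ := hx
  refine ⟨L.1 * p, ?_, by simp⟩
  have h1 : L.1.IsHomogeneous 1 := L.2
  have h2 : p.IsHomogeneous d := hp
  have h3 := h1.mul h2
  rw [add_comm] at h3
  exact h3

/-- Multiplication by a linear form `L`, as a linear map `[R/I]_d → [R/I]_{d+1}`. -/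
def mulLinearForm {K : Type*} [Field K] {r : ℕ} (I : Ideal (MvPolynomial (Fin r) K))
    (L : MvPolynomial.homogeneousSubmodule (Fin r) K 1) (d : ℕ) :
    gradedPiece I d →ₗ[K] gradedPiece I (d + 1) :=
  (LinearMap.mulLeft K (Ideal.Quotient.mk I L.1)).restrict (mul_mem_gradedPiece I L d)

/-- `e` is the socle degree of the graded (artinian Gorenstein) algebra `R/I`: the largest degree
in which `R/I` is nonzero. -/
def IsSocleDegree {K : Type*} [Field K] {r : ℕ} (I : Ideal (MvPolynomial (Fin r) K)) (e : ℕ) :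
    Prop :=
  IsGreatest {d : ℕ | gradedPiece I d ≠ ⊥} e

/-- `Q_1, …, Q_r` are quadrics in `K[x_1, …, x_r]` that generate an artinian complete
intersection: they form a regular sequence, and the quotient by them is artinian. -/
structure IsArtinianCIOfQuadrics {K : Type*} [Field K] {r : ℕ}
    (Q : Fin r → MvPolynomial (Fin r) K) : Prop where
  isHomogeneous : ∀ i, (Q i).IsHomogeneous 2
  isRegular : RingTheory.Sequence.IsRegular (MvPolynomial (Fin r) K) (List.ofFn Q)
  isArtinianRing : IsArtinianRing (MvPolynomial (Fin r) K ⧸ Ideal.span (Set.range Q))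

/-- The linear form `a_1 x_1 + ⋯ + a_r x_r`. -/
def linearForm {K : Type*} [Field K] {r : ℕ} (a : Fin r → K) :
    MvPolynomial.homogeneousSubmodule (Fin r) K 1 :=
  ⟨∑ i, MvPolynomial.C (a i) * MvPolynomial.X i,
    MvPolynomial.IsHomogeneous.sum _ _ _ fun i _ => by
      simpa using (MvPolynomial.isHomogeneous_C (Fin r) (a i)).mul
        (MvPolynomial.isHomogeneous_X K i)⟩

/-- `U` is a Zariski open subset of the affine space `K^r`: the complement of the common zeros of
some set of polynomials. -/
def IsZariskiOpen {K : Type*} [Field K] {r : ℕ} (U : Set (Fin r → K)) : Prop :=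
  ∃ S : Set (MvPolynomial (Fin r) K), U = {a | ∀ f ∈ S, MvPolynomial.eval a f = 0}ᶜ

/-- `P` holds for a general linear form: it holds for all linear forms whose coefficient vector
lies in some nonempty Zariski open subset of `K^r`. -/
def ForGeneralLinearForm {K : Type*} [Field K] {r : ℕ}
    (P : MvPolynomial.homogeneousSubmodule (Fin r) K 1 → Prop) : Prop :=
  ∃ U : Set (Fin r → K), IsZariskiOpen U ∧ U.Nonempty ∧ ∀ a ∈ U, P (linearForm a)

end

end QuadricCI

/-! Write `β a b` for the class of `L_a * L_b` in `R/I`. Injectivity of `β a` is a determinantal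
open condition on `a`, so one good `a` suffices. Suppose every `β a` has a kernel. Take `a` of
maximal rank and `β a b = 0`. Moving `a` in direction `v` cannot raise the rank, so `β v b` lies in
the range of `β a`. An independent pair `a, b` of this kind must exist: otherwise `β a a = 0` for
all `a` of maximal rank, and polarization forces `β = 0`, where any pair works.

The pairs `(v, w)` with `L_v L_b + L_a L_w ∈ I` thus form a space of dimension at least `r + 1`.
Passing to the quadric loses at most one dimension, the syzygy `(a, -b)`, while `I` has at most `r`
independent quadrics. Hence every `Q i` lies in `(L_a, L_b)` (`exists_eq_mul_add_mul`). As `r ≥ 3`,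
these two forms share a nonzero zero, so `R/I` is nonzero in every degree, against the finite socle
degree. -/

namespace QuadricCI

open Module

/-! ### Linear systems of linear maps and maximal rank -/

section Pencil

variable {K E A : Type*} [Field K] [AddCommGroup E] [Module K E] [AddCommGroup A] [Module K A]

/-- Linear independence is preserved along a line, away from finitely many parameters. -/
theorem finite_setOf_not_linearIndependent_add_smul {n : ℕ} {x : Fin n → A}
    (hx : LinearIndependent K x) (y : Fin n → A) :
    {t : K | ¬ LinearIndependent K fun i => x i + t • y i}.Finite := by
  obtain ⟨ψ, hψ⟩ := (Fintype.linearCombination K x).exists_leftInverse_of_injective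
    (LinearMap.ker_eq_bot.2 (linearIndependent_iff_injective_fintypeLinearCombination.1 hx))
  have hψx (i : Fin n) : ψ (x i) = Pi.single i 1 := by
    have := LinearMap.congr_fun hψ (Pi.single i 1)
    simpa [Fintype.linearCombination_apply_single] using this
  -- The sign makes `C.charpolyRev` equal to `det (1 + T ψ(y))`, which is `1` at `T = 0`.
  let C : Matrix (Fin n) (Fin n) K := Matrix.of fun i j => - ψ (y i) j
  have hne : C.charpolyRev ≠ 0 := fun h => by
    simpa [h] using Matrix.eval_charpolyRev (M := C)
  refine (Polynomial.finite_setOfPred_isRoot hne).subset fun t ht => ?_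
  by_contra hroot
  apply ht
  apply LinearIndependent.of_comp ψ
  have hdet : (Matrix.of fun i => ψ (x i + t • y i)).det = C.charpolyRev.eval t := by
    rw [Matrix.charpolyRev, ← Polynomial.coe_evalRingHom, RingHom.map_det]
    congr 1
    ext i j
    by_cases hij : i = j
    · subst hij
      simp [hψx, C, Matrix.sub_apply, mul_comm t]
    · simp [hψx, C, Matrix.sub_apply, hij, Ne.symm hij, mul_comm t]
  have hunit : IsUnit (Matrix.of fun i => ψ (x i + t • y i)) := by
    rw [Matrix.isUnit_iff_isUnit_det, hdet]
    exact IsUnit.mk0 _ hroot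
  exact Matrix.linearIndependent_rows_iff_isUnit.2 hunit

variable [FiniteDimensional K E]

theorem exists_linearIndependent_comp (f : E →ₗ[K] A) :
    ∃ u : Fin (finrank K (LinearMap.range f)) → E, LinearIndependent K fun i => f (u i) := by
  let b := finBasis K (LinearMap.range f)
  choose u hu using fun i => (b i).2
  refine ⟨u, ?_⟩
  simp only [hu]
  exact b.linearIndependent.map' (LinearMap.range f).subtype (Submodule.ker_subtype _)

theorem le_finrank_range_of_linearIndependent {n : ℕ} {x : Fin n → A}
    (hx : LinearIndependent K x) {f : E →ₗ[K] A} (hf : ∀ i, x i ∈ LinearMap.range f) :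
    n ≤ finrank K (LinearMap.range f) := by
  have : LinearIndependent K fun i => (⟨x i, hf i⟩ : LinearMap.range f) :=
    LinearIndependent.of_comp (LinearMap.range f).subtype hx
  simpa using this.fintype_card_le_finrank

/-- Lower semicontinuity of rank: vectors with independent images under `f` keep independent images
for almost all `t`. -/
theorem finite_setOf_finrank_range_add_smul_lt (f g : E →ₗ[K] A) :
    {t : K | finrank K (LinearMap.range (f + t • g)) < finrank K (LinearMap.range f)}.Finite := by
  obtain ⟨u, hu⟩ := exists_linearIndependent_comp f
  refine (finite_setOf_not_linearIndependent_add_smul hu fun i => g (u i)).subset fun t ht h => ?_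
  exact ht.not_ge (le_finrank_range_of_linearIndependent h fun i => ⟨u i, by simp⟩)

/-- First order deformations of a linear map of maximal rank in a pencil send its kernel into its
range. -/
theorem apply_mem_range_of_finrank_range_le [Infinite K] {f g : E →ₗ[K] A}
    (hfg : ∀ t : K, finrank K (LinearMap.range (f + t • g)) ≤ finrank K (LinearMap.range f))
    {b : E} (hb : f b = 0) : g b ∈ LinearMap.range f := by
  by_contra hgb
  obtain ⟨u, hu⟩ := exists_linearIndependent_comp f
  have hx : LinearIndependent K (Fin.cons (g b) fun i => f (u i) : Fin (_ + 1) → A) := by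
    refine linearIndependent_finCons.2 ⟨hu, fun h => hgb ?_⟩
    refine Submodule.span_le.2 ?_ h
    rintro _ ⟨i, rfl⟩
    exact ⟨u i, rfl⟩
  -- For `t ≠ 0`, `g b = (f + t • g) (t⁻¹ • b)` because `f b = 0`; so a generic `t` would have rank
  -- one more than `f`.
  obtain ⟨t, ht⟩ := ((finite_setOf_not_linearIndependent_add_smul hx
    (Fin.cons 0 fun i => g (u i))).union (Set.finite_singleton 0)).exists_notMem
  simp only [Set.mem_union, Set.mem_ofPred_eq, Set.mem_singleton_iff, not_or, not_not] at ht
  have := le_finrank_range_of_linearIndependent (f := f + t • g) ht.1 (by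
    refine Fin.cases ?_ fun i => ?_
    · exact ⟨t⁻¹ • b, by simp [hb, ht.2]⟩
    · exact ⟨u i, by simp⟩)
  have := hfg t
  omega

/-- If every member of a linear system of linear maps `β a`, with `β` symmetric, has a
kernel, then there is a degenerate pair of independent vectors at which the degeneration can be
followed to first order in every direction. -/
theorem exists_linearIndependent_pair_of_forall_exists_eq_zero [CharZero K]
    (β : E →ₗ[K] E →ₗ[K] A) (hβ : ∀ a b, β a b = β b a) (hE : 1 < finrank K E)
    (h : ∀ a, ∃ b ≠ 0, β a b = 0) :
    ∃ a b, LinearIndependent K ![a, b] ∧ β a b = 0 ∧ ∀ v, ∃ w, β v b + β a w = 0 := by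
  have hbdd : BddAbove (Set.range fun a => finrank K (LinearMap.range (β a))) := by
    refine ⟨finrank K E, ?_⟩
    rintro _ ⟨a, rfl⟩
    exact LinearMap.finrank_range_le _
  obtain ⟨a₀, ha₀⟩ := Nat.sSup_mem (Set.range_nonempty _) hbdd
  have hmax (a : E) : finrank K (LinearMap.range (β a)) ≤ finrank K (LinearMap.range (β a₀)) := by
    simp only at ha₀
    rw [ha₀]
    exact le_csSup hbdd ⟨a, rfl⟩
  by_contra! hcon
  have hpar (a : E)
      (ha : finrank K (LinearMap.range (β a₀)) ≤ finrank K (LinearMap.range (β a)))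
      (b : E) (hab : β a b = 0) : ¬ LinearIndependent K ![a, b] := by
    intro hli
    obtain ⟨v, hv⟩ := hcon a b hli hab
    obtain ⟨w, hw⟩ := apply_mem_range_of_finrank_range_le (f := β a) (g := β v)
      (fun t => by
        rw [← map_smul, ← map_add]
        exact (hmax (a + t • v)).trans ha) hab
    exact hv (-w) (by simp [hw])
  -- The kernel contains some `b ≠ 0`, and by `hpar` it is parallel to `a`.
  have hself (a : E)
      (ha : finrank K (LinearMap.range (β a₀)) ≤ finrank K (LinearMap.range (β a))) :
      β a a = 0 := by
    obtain ⟨b, hb, hab⟩ := h a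
    have h1 := hpar a ha b hab
    rw [LinearIndependent.pair_symm_iff, LinearIndependent.pair_iff' hb] at h1
    push Not at h1
    obtain ⟨c, hc⟩ := h1
    nth_rw 2 [← hc]
    simp [hab]
  -- Polarization: `β (a₀ + t v) (a₀ + t v) = 0` for almost all `t`. Two distinct nonzero values
  -- give `β v v = 0`, then `2 β a₀ v = 0`.
  have hzero : β a₀ = 0 := by
    ext v
    have hfin := finite_setOf_finrank_range_add_smul_lt (β a₀) (β v)
    have hgood (t : K) (ht : t ∉ {t : K | finrank K (LinearMap.range (β a₀ + t • β v)) <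
        finrank K (LinearMap.range (β a₀))}) (ht0 : t ≠ 0) :
        (2 : K) • β a₀ v + t • β v v = 0 := by
      have h0 := hself a₀ le_rfl
      have h1 := hself (a₀ + t • v) (by
        rw [map_add, map_smul]
        exact not_lt.1 ht)
      simp only [map_add, map_smul, LinearMap.add_apply, LinearMap.smul_apply, h0,
        hβ v a₀] at h1
      have h2 : t • ((2 : K) • β a₀ v + t • β v v) = 0 := by
        rw [← h1]; module
      exact (smul_eq_zero.1 h2).resolve_left ht0
    obtain ⟨s, hs⟩ := (hfin.union (Set.finite_singleton 0)).exists_notMem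
    obtain ⟨t, ht⟩ := (hfin.union (Set.toFinite {0, s})).exists_notMem
    simp only [Set.mem_union, Set.mem_singleton_iff, Set.mem_insert_iff, not_or] at hs ht
    have e1 := hgood s hs.1 hs.2
    have e2 := hgood t ht.1 ht.2.1
    have e3 : (t - s) • β v v = 0 := by
      rw [sub_smul, sub_eq_zero]
      exact add_left_cancel (e2.trans e1.symm)
    have e4 := (smul_eq_zero.1 e3).resolve_left (sub_ne_zero.2 ht.2.2)
    simpa [e4] using e1
  have : Nontrivial E := nontrivial_of_finrank_pos (R := K) (by omega)
  obtain ⟨a, ha⟩ := exists_ne (0 : E)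
  have hr : finrank K (LinearMap.range (β a)) = 0 := by
    have := hmax a
    rwa [hzero, LinearMap.range_zero, finrank_bot, Nat.le_zero] at this
  have hβa : β a = 0 := by
    exact LinearMap.range_eq_bot.1 (Submodule.finrank_eq_zero.1 hr)
  obtain ⟨b, hb⟩ := exists_linearIndependent_pair_of_one_lt_finrank hE ha
  exact hpar a (by rw [hβa, hzero]) b (by simp [hβa]) hb

end Pencil
end QuadricCI

/-! ### Products of linear forms modulo `I`, and openness of injectivity -/

namespace QuadricCI

open Module MvPolynomial

variable {K : Type*} [Field K] {r : ℕ}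

/-- The linear map sending a coefficient vector to its linear form. -/
noncomputable def linForm (K : Type*) [Field K] (r : ℕ) : (Fin r → K) →ₗ[K] MvPolynomial (Fin r) K :=
  Fintype.linearCombination K X

theorem linearForm_coe (a : Fin r → K) :
    (linearForm a : MvPolynomial (Fin r) K) = linForm K r a := by
  simp [linearForm, linForm, Fintype.linearCombination_apply, smul_eq_C_mul]

theorem isHomogeneous_linForm (a : Fin r → K) : (linForm K r a).IsHomogeneous 1 := by
  rw [← linearForm_coe]
  exact (linearForm a).2

theorem eval_linForm (a p : Fin r → K) : eval p (linForm K r a) = a ⬝ᵥ p := by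
  simp [linForm, Fintype.linearCombination_apply, dotProduct, smul_eval]

theorem linForm_injective : Function.Injective (linForm K r) := by
  intro a b hab
  refine funext fun i => ?_
  have := congrArg (eval (Pi.single i 1)) hab
  simpa [eval_linForm] using this

theorem range_linForm : LinearMap.range (linForm K r) = homogeneousSubmodule (Fin r) K 1 := by
  rw [linForm, Fintype.range_linearCombination, homogeneousSubmodule_one_eq_span_X]

/-- The symmetric bilinear map `(a, b) ↦ L_a L_b` with values in `R/I`. -/
noncomputable def mulForms (I : Ideal (MvPolynomial (Fin r) K)) :
    (Fin r → K) →ₗ[K] (Fin r → K) →ₗ[K] MvPolynomial (Fin r) K ⧸ I :=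
  ((LinearMap.mul K (MvPolynomial (Fin r) K)).compl₁₂ (linForm K r) (linForm K r)).compr₂
    (Ideal.Quotient.mkₐ K I).toLinearMap

theorem mulForms_apply (I : Ideal (MvPolynomial (Fin r) K)) (a b : Fin r → K) :
    mulForms I a b = Ideal.Quotient.mk I (linForm K r a * linForm K r b) := by
  simp [mulForms]

theorem injective_mulLinearForm_of_injective_mulForms {I : Ideal (MvPolynomial (Fin r) K)}
    {a : Fin r → K} (h : Function.Injective (mulForms I a)) :
    Function.Injective (mulLinearForm I (linearForm a) 1) := by
  rw [injective_iff_map_eq_zero]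
  rintro ⟨_, p, hp, rfl⟩ h0
  rw [← range_linForm] at hp
  obtain ⟨b, rfl⟩ := hp
  have h1 : mulForms I a b = 0 := by
    have := congrArg Subtype.val h0
    simpa [mulLinearForm, mulForms_apply, linearForm_coe] using this
  have hb : b = 0 := h (by simpa using h1)
  simp [hb]

/-- Injectivity of a linear map depending linearly on a parameter is a Zariski open condition. -/
theorem exists_isZariskiOpen_injective {A : Type*} [AddCommGroup A] [Module K A]
    (β : (Fin r → K) →ₗ[K] (Fin r → K) →ₗ[K] A) {a₀ : Fin r → K}
    (h : Function.Injective (β a₀)) :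
    ∃ U : Set (Fin r → K), IsZariskiOpen U ∧ U.Nonempty ∧ ∀ a ∈ U, Function.Injective (β a) := by
  obtain ⟨ψ, hψ⟩ := (β a₀).exists_leftInverse_of_injective (LinearMap.ker_eq_bot.2 h)
  -- The matrix of `ψ ∘ₗ β a` with `a` replaced by indeterminates; at `a₀` it is the identity.
  let M : Matrix (Fin r) (Fin r) (MvPolynomial (Fin r) K) := Matrix.of fun i j =>
    linForm K r fun k => ψ (β (Pi.single k 1) (Pi.single j 1)) i
  have hM (a : Fin r → K) : eval a M.det = (LinearMap.toMatrix' (ψ ∘ₗ β a)).det := by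
    rw [RingHom.map_det]
    congr 1
    ext i j
    have ha : β a = ∑ k, a k • β (Pi.single k 1) := by
      conv_lhs => rw [pi_eq_sum_univ' a]
      simp
    simp [M, eval_linForm, LinearMap.toMatrix'_apply, ha, dotProduct,
      Finset.sum_apply, mul_comm]
  refine ⟨_, ⟨{M.det}, rfl⟩, ⟨a₀, ?_⟩, fun a ha => ?_⟩
  · simp [hM, hψ]
  · have h1 : (LinearMap.toMatrix' (ψ ∘ₗ β a)).det ≠ 0 := by
      simpa [hM] using ha
    have h2 : LinearMap.ker (ψ ∘ₗ β a) = ⊥ := by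
      by_contra hk
      exact h1 (by
        rw [LinearMap.det_toMatrix']
        exact LinearMap.det_eq_zero_iff_ker_ne_bot.2 hk)
    exact Function.Injective.of_comp (f := ψ) (LinearMap.ker_eq_bot.1 h2)

/-! ### The quadrics in `I` at a degenerate pair -/

theorem homogeneousComponent_mul_of_isHomogeneous {n : ℕ} {q : MvPolynomial (Fin r) K}
    (hq : q.IsHomogeneous n) (c : MvPolynomial (Fin r) K) :
    homogeneousComponent n (c * q) = C (coeff 0 c) * q := by
  induction c using MvPolynomial.induction_on' with
  | monomial s a =>
    have h := (isHomogeneous_monomial a (rfl : s.degree = s.degree)).mul hq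
    rw [homogeneousComponent_of_mem h]
    by_cases hs : s = 0
    · rw [hs, if_pos (by simp), coeff_monomial, if_pos rfl, C_apply]
    · have : s.degree ≠ 0 := by simpa [Finsupp.degree_eq_zero_iff] using hs
      rw [if_neg (by omega), coeff_monomial, if_neg hs, C_0, zero_mul]
  | add p p' hp hp' => rw [add_mul, map_add, hp, hp', coeff_add, C_add, add_mul]

/-- Only the constant terms of the coefficients contribute in degree 2. This bounds the dimension of
the space of quadrics in `I` by `r`. -/
theorem mem_span_of_isHomogeneous_two {Q : Fin r → MvPolynomial (Fin r) K}
    (hQ : ∀ i, (Q i).IsHomogeneous 2) {f : MvPolynomial (Fin r) K} (hf : f.IsHomogeneous 2)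
    (hfI : f ∈ Ideal.span (Set.range Q)) : f ∈ Submodule.span K (Set.range Q) := by
  obtain ⟨c, hc⟩ := Ideal.mem_span_range_iff_exists_fun.1 hfI
  have h := congrArg (homogeneousComponent 2) hc
  rw [homogeneousComponent_eq_self hf, map_sum] at h
  rw [← h]
  refine Submodule.sum_mem _ fun i _ => ?_
  rw [homogeneousComponent_mul_of_isHomogeneous (hQ i), ← smul_eq_C_mul]
  exact Submodule.smul_mem _ _ (Submodule.subset_span ⟨i, rfl⟩)

theorem exists_eq_smul_of_dotProduct {a v : Fin r → K} (h : ∀ p, a ⬝ᵥ p = 0 → v ⬝ᵥ p = 0) :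
    ∃ c : K, v = c • a := by
  by_cases ha : a = 0
  · subst ha
    refine ⟨0, funext fun i => ?_⟩
    simpa using h (Pi.single i 1) (by simp)
  · obtain ⟨i, hi⟩ := Function.ne_iff.1 ha
    simp only [Pi.zero_apply] at hi
    refine ⟨v i / a i, funext fun j => ?_⟩
    have := h (a i • Pi.single j 1 - a j • Pi.single i 1) (by
      simp [dotProduct_sub, dotProduct_smul, mul_comm])
    simp [dotProduct_sub, dotProduct_smul, sub_eq_zero] at this
    simp only [Pi.smul_apply, smul_eq_mul]
    field_simp
    linear_combination this

/-- On the hyperplane `a = 0` the product `L_v L_b` vanishes. A vector space is not the union of two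
proper subspaces, and `b` is not identically zero there, so `v` is. -/
theorem exists_eq_smul_of_mul_add_mul_eq_zero {a b v w : Fin r → K}
    (hab : LinearIndependent K ![a, b])
    (h : linForm K r v * linForm K r b + linForm K r a * linForm K r w = 0) :
    ∃ c : K, v = c • a ∧ w = -c • b := by
  have ha : a ≠ 0 := hab.ne_zero 0
  have hzero (p : Fin r → K) (hp : a ⬝ᵥ p = 0) : v ⬝ᵥ p = 0 ∨ b ⬝ᵥ p = 0 := by
    have := congrArg (eval p) h
    simpa [eval_linForm, hp] using this
  obtain ⟨p₁, hp₁, hbp₁⟩ : ∃ p, a ⬝ᵥ p = 0 ∧ b ⬝ᵥ p ≠ 0 := by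
    by_contra! hcon
    obtain ⟨c, hc⟩ := exists_eq_smul_of_dotProduct hcon
    exact (LinearIndependent.pair_iff' ha).1 hab c hc.symm
  obtain ⟨c, rfl⟩ : ∃ c : K, v = c • a := by
    refine exists_eq_smul_of_dotProduct fun p hp => ?_
    by_contra hv
    have hb := (hzero p hp).resolve_left hv
    have hv1 := (hzero p₁ hp₁).resolve_right hbp₁
    rcases hzero (p + p₁) (by simp [dotProduct_add, hp, hp₁]) with h' | h'
    · simp [dotProduct_add, hv1, hv] at h'
    · simp [dotProduct_add, hb, hbp₁] at h'
  refine ⟨c, rfl, ?_⟩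
  have h1 : linForm K r a * linForm K r (c • b + w) = 0 := by
    rw [← h]
    simp only [map_add, map_smul, smul_eq_C_mul]
    ring
  have h2 : linForm K r a ≠ 0 := by
    rw [Ne, map_eq_zero_iff _ linForm_injective]
    exact ha
  have h3 : c • b + w = 0 :=
    (map_eq_zero_iff _ linForm_injective).1 ((mul_eq_zero.1 h1).resolve_left h2)
  rw [neg_smul]
  exact eq_neg_of_add_eq_zero_right h3

/-- If the quadrics degenerate to first order along all directions at the reducible member
`L_a L_b`, then all of them lie in the ideal `(L_a, L_b)`. -/
theorem exists_eq_mul_add_mul {Q : Fin r → MvPolynomial (Fin r) K}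
    (hQ : ∀ i, (Q i).IsHomogeneous 2) {a b : Fin r → K} (hab : LinearIndependent K ![a, b])
    (h0 : mulForms (Ideal.span (Set.range Q)) a b = 0)
    (h : ∀ v, ∃ w, mulForms (Ideal.span (Set.range Q)) v b +
      mulForms (Ideal.span (Set.range Q)) a w = 0) (i : Fin r) :
    ∃ v w, Q i = linForm K r v * linForm K r b + linForm K r a * linForm K r w := by
  set I := Ideal.span (Set.range Q)
  let Φ : (Fin r → K) × (Fin r → K) →ₗ[K] MvPolynomial (Fin r) K :=
    ((LinearMap.mulRight K (linForm K r b)) ∘ₗ linForm K r).coprod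
      ((LinearMap.mulLeft K (linForm K r a)) ∘ₗ linForm K r)
  have hΦ (z : (Fin r → K) × (Fin r → K)) :
      Φ z = linForm K r z.1 * linForm K r b + linForm K r a * linForm K r z.2 := by
    simp [Φ]
  let Z : Submodule K ((Fin r → K) × (Fin r → K)) := (I.restrictScalars K).comap Φ
  have hZ (z : (Fin r → K) × (Fin r → K)) :
      z ∈ Z ↔ mulForms I z.1 b + mulForms I a z.2 = 0 := by
    rw [mulForms_apply, mulForms_apply, ← map_add, Ideal.Quotient.eq_zero_iff_mem, ← hΦ]
    rfl
  have hb : b ≠ 0 := hab.ne_zero 1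
  -- Projection to `v` is onto by `h`, and its kernel contains `(0, b)` because `L_a L_b ∈ I`.
  have h1 : r + 1 ≤ finrank K Z := by
    let π : Z →ₗ[K] (Fin r → K) := LinearMap.fst K _ _ ∘ₗ Z.subtype
    have hπ : LinearMap.range π = ⊤ := by
      rw [LinearMap.range_eq_top]
      intro v
      obtain ⟨w, hw⟩ := h v
      exact ⟨⟨(v, w), (hZ _).2 hw⟩, rfl⟩
    have hker : 0 < finrank K (LinearMap.ker π) := by
      refine Nat.pos_of_ne_zero fun hcon => hb ?_
      have hmem : (⟨(0, b), (hZ _).2 (by simp [h0])⟩ : Z) ∈ LinearMap.ker π := rfl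
      rw [Submodule.finrank_eq_zero.1 hcon, Submodule.mem_bot] at hmem
      exact congrArg (fun z : Z => z.1.2) hmem
    have := π.finrank_range_add_finrank_ker
    rw [hπ, finrank_top, finrank_fin_fun] at this
    omega
  let Ψ : Z →ₗ[K] MvPolynomial (Fin r) K := Φ ∘ₗ Z.subtype
  have h2 : finrank K (LinearMap.ker Ψ) ≤ 1 := by
    have hle : (LinearMap.ker Ψ).map Z.subtype ≤ K ∙ (a, -b) := by
      rintro _ ⟨z, hz, rfl⟩
      have hz' : Φ z = 0 := hz
      rw [hΦ] at hz'
      obtain ⟨c, hc1, hc2⟩ := exists_eq_smul_of_mul_add_mul_eq_zero hab hz'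
      refine Submodule.mem_span_singleton.2 ⟨c, ?_⟩
      ext1
      · exact hc1.symm
      · simp [hc2]
    rw [← Submodule.finrank_map_subtype_eq]
    exact (Submodule.finrank_mono hle).trans ((finrank_span_le_card _).trans (by simp))
  have h3 : LinearMap.range Ψ ≤ Submodule.span K (Set.range Q) := by
    rintro _ ⟨z, rfl⟩
    refine mem_span_of_isHomogeneous_two hQ ?_ z.2
    change (Φ z).IsHomogeneous 2
    rw [hΦ]
    exact ((isHomogeneous_linForm _).mul (isHomogeneous_linForm _)).add
      ((isHomogeneous_linForm _).mul (isHomogeneous_linForm _))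
  have : FiniteDimensional K (Submodule.span K (Set.range Q)) :=
    FiniteDimensional.span_of_finite K (Set.finite_range Q)
  have h4 : LinearMap.range Ψ = Submodule.span K (Set.range Q) := by
    refine Submodule.eq_of_le_of_finrank_le h3 ?_
    have h5 : finrank K (Submodule.span K (Set.range Q)) ≤ r := by
      simpa [Set.finrank] using finrank_range_le_card (R := K) Q
    have := Ψ.finrank_range_add_finrank_ker
    omega
  have hi : Q i ∈ LinearMap.range Ψ := h4 ▸ Submodule.subset_span ⟨i, rfl⟩
  obtain ⟨z, hz⟩ := hi
  exact ⟨z.1.1, z.1.2, by rw [← hΦ, ← hz]; rfl⟩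

/-! ### Common zeros and nonvanishing graded pieces -/

theorem exists_common_zero (hr : 3 ≤ r) (a b : Fin r → K) :
    ∃ p : Fin r → K, p ≠ 0 ∧ a ⬝ᵥ p = 0 ∧ b ⬝ᵥ p = 0 := by
  let f : (Fin r → K) →ₗ[K] (Fin 2 → K) := Matrix.toLin' (Matrix.of ![a, b])
  have hf : LinearMap.ker f ≠ ⊥ := LinearMap.ker_ne_bot_of_finrank_lt (by simp; omega)
  obtain ⟨p, hp, hp0⟩ := Submodule.exists_mem_ne_zero_of_ne_bot hf
  have hp' : f p = 0 := hp
  refine ⟨p, hp0, ?_, ?_⟩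
  · simpa [f, Matrix.mulVec] using congrFun hp' 0
  · simpa [f, Matrix.mulVec] using congrFun hp' 1

theorem gradedPiece_eq_bot_iff {I : Ideal (MvPolynomial (Fin r) K)} {d : ℕ} :
    gradedPiece I d = ⊥ ↔ ∀ f : MvPolynomial (Fin r) K, f.IsHomogeneous d → f ∈ I := by
  rw [gradedPiece, ← le_bot_iff, Submodule.map_le_iff_le_comap]
  refine forall_congr' fun f => imp_congr Iff.rfl ?_
  simp [Ideal.Quotient.eq_zero_iff_mem]

/-- Quadrics with a common projective zero generate an ideal missing forms of every degree. -/
theorem gradedPiece_ne_bot_of_common_zero {Q : Fin r → MvPolynomial (Fin r) K} {p : Fin r → K}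
    (hp : p ≠ 0) (hQ : ∀ i, eval p (Q i) = 0) (d : ℕ) :
    gradedPiece (Ideal.span (Set.range Q)) d ≠ ⊥ := by
  obtain ⟨j, hj⟩ := Function.ne_iff.1 hp
  intro h
  have h1 := gradedPiece_eq_bot_iff.1 h (X j ^ d) (isHomogeneous_X_pow j d)
  have h2 : Ideal.span (Set.range Q) ≤ RingHom.ker (eval p) := by
    rw [Ideal.span_le]
    rintro _ ⟨i, rfl⟩
    exact hQ i
  have h3 : eval p (X j ^ d) = 0 := h2 h1
  rw [map_pow, eval_X] at h3
  exact hj (eq_zero_of_pow_eq_zero h3)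

/-! ### Socle degree in at most two variables -/

theorem gradedPiece_eq_bot_of_le {I : Ideal (MvPolynomial (Fin r) K)} {d e : ℕ} (hde : d ≤ e)
    (h : gradedPiece I d = ⊥) : gradedPiece I e = ⊥ := by
  rw [gradedPiece_eq_bot_iff] at h ⊢
  intro f hf
  have hf' : f ∈ homogeneousSubmodule (Fin r) K d * homogeneousSubmodule (Fin r) K (e - d) := by
    rw [← homogeneousSubmodule_one_pow K d, ← homogeneousSubmodule_one_pow K (e - d), ← pow_add,
      Nat.add_sub_cancel' hde, homogeneousSubmodule_one_pow]
    exact hf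
  refine Submodule.mul_induction_on hf' (fun g hg g' _ => I.mul_mem_right _ (h g hg))
    fun g g' hg hg' => I.add_mem hg hg'

theorem finrank_homogeneousSubmodule_le {ι : Type*} [Fintype ι] {d : ℕ} (m : ι → Fin r →₀ ℕ)
    (hm : ∀ s : Fin r →₀ ℕ, s.degree = d → ∃ i, m i = s) :
    finrank K (homogeneousSubmodule (Fin r) K d) ≤ Fintype.card ι := by
  let g : homogeneousSubmodule (Fin r) K d →ₗ[K] (ι → K) :=
    LinearMap.pi (fun i => lcoeff K (m i)) ∘ₗ Submodule.subtype _
  have hg : Function.Injective g := by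
    rw [injective_iff_map_eq_zero]
    rintro ⟨f, hf⟩ h0
    refine Subtype.ext (MvPolynomial.ext _ _ fun s => ?_)
    by_cases hs : s.degree = d
    · obtain ⟨i, rfl⟩ := hm s hs
      exact congrFun h0 i
    · exact IsHomogeneous.coeff_eq_zero hf hs
  simpa using LinearMap.finrank_le_finrank_of_injective hg

/-- Regularity makes the four cubics `x_i Q_j` independent, and binary cubics have dimension 4, so
`I` contains them all. -/
theorem gradedPiece_three_eq_bot {Q : Fin 2 → MvPolynomial (Fin 2) K}
    (hQ : IsArtinianCIOfQuadrics Q) : gradedPiece (Ideal.span (Set.range Q)) 3 = ⊥ := by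
  have hreg := hQ.isRegular.toIsWeaklyRegular
  have hlist : List.ofFn Q = [Q 0, Q 1] := by simp [List.ofFn_succ]
  rw [hlist, RingTheory.Sequence.isWeaklyRegular_cons_iff,
    RingTheory.Sequence.isWeaklyRegular_singleton_iff] at hreg
  obtain ⟨hreg0, hreg1⟩ := hreg
  have hQ0 : Q 0 ≠ 0 := fun h0 => by
    rw [h0] at hreg0
    exact one_ne_zero (hreg0 (by simp) : (1 : MvPolynomial (Fin 2) K) = 0)
  -- `Q 1` is a nonzerodivisor modulo `Q 0`, so `Q 0` divides `L_v`; degrees then force `L_v = 0`.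
  have hzero (u v : Fin 2 → K) (huv : linForm K 2 u * Q 0 + linForm K 2 v * Q 1 = 0) :
      v = 0 := by
    have h1 : (Submodule.Quotient.mk (linForm K 2 v) :
        QuotSMulTop (Q 0) (MvPolynomial (Fin 2) K)) = 0 := by
      refine hreg1 ?_
      simp only [smul_zero]
      rw [← Submodule.Quotient.mk_smul, Submodule.Quotient.mk_eq_zero]
      refine Submodule.mem_smul_pointwise_iff_exists _ _ _ |>.2 ⟨-linForm K 2 u, trivial, ?_⟩
      simp only [smul_eq_mul]
      linear_combination -huv
    rw [Submodule.Quotient.mk_eq_zero, Submodule.mem_smul_pointwise_iff_exists] at h1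
    obtain ⟨q, -, hq⟩ := h1
    by_contra hv
    have hv' : linForm K 2 v ≠ 0 := by
      rwa [Ne, map_eq_zero_iff _ linForm_injective]
    have hdeg := (isHomogeneous_linForm v).totalDegree hv'
    rw [← hq, smul_eq_mul] at hv' hdeg
    rw [totalDegree_mul_of_isDomain hQ0 (right_ne_zero_of_mul hv'),
      (hQ.isHomogeneous 0).totalDegree hQ0] at hdeg
    omega
  let Φ : (Fin 2 → K) × (Fin 2 → K) →ₗ[K] MvPolynomial (Fin 2) K :=
    ((LinearMap.mulRight K (Q 0)) ∘ₗ linForm K 2).coprod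
      ((LinearMap.mulRight K (Q 1)) ∘ₗ linForm K 2)
  have hΦ (z : (Fin 2 → K) × (Fin 2 → K)) :
      Φ z = linForm K 2 z.1 * Q 0 + linForm K 2 z.2 * Q 1 := by
    simp [Φ]
  have hinj : Function.Injective Φ := by
    rw [injective_iff_map_eq_zero]
    rintro ⟨u, v⟩ h0
    rw [hΦ] at h0
    obtain rfl := hzero u v h0
    simp only [map_zero, zero_mul, add_zero, mul_eq_zero, hQ0, or_false,
      map_eq_zero_iff _ linForm_injective] at h0
    rw [h0, Prod.mk_zero_zero]
  have hle : LinearMap.range Φ ≤ homogeneousSubmodule (Fin 2) K 3 := by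
    rintro _ ⟨z, rfl⟩
    rw [hΦ]
    exact ((isHomogeneous_linForm _).mul (hQ.isHomogeneous 0)).add
      ((isHomogeneous_linForm _).mul (hQ.isHomogeneous 1))
  have hdim : finrank K (homogeneousSubmodule (Fin 2) K 3) ≤ 4 := by
    refine finrank_homogeneousSubmodule_le (ι := Fin 4)
      (fun i => Finsupp.equivFunOnFinite.symm ![i, 3 - i]) fun s hs => ?_
    have hs' : s 0 + s 1 = 3 := by
      simpa [Finsupp.degree_eq_sum, Fin.sum_univ_two] using hs
    refine ⟨⟨s 0, by omega⟩, Finsupp.ext fun j => ?_⟩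
    fin_cases j
    · simp
    · simp; omega
  have : FiniteDimensional K (homogeneousSubmodule (Fin 2) K 3) :=
    Module.Finite.iff_fg.2 (homogeneousSubmodule_fg (Fin 2) K 3)
  have heq : LinearMap.range Φ = homogeneousSubmodule (Fin 2) K 3 := by
    refine Submodule.eq_of_le_of_finrank_le hle (hdim.trans ?_)
    rw [LinearMap.finrank_range_of_inj hinj]
    simp
  rw [gradedPiece_eq_bot_iff]
  intro f hf
  obtain ⟨z, rfl⟩ : f ∈ LinearMap.range Φ := by rw [heq]; exact hf
  rw [hΦ]
  exact Ideal.add_mem _ (Ideal.mul_mem_left _ _ (Ideal.subset_span ⟨0, rfl⟩))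
    (Ideal.mul_mem_left _ _ (Ideal.subset_span ⟨1, rfl⟩))

theorem gradedPiece_two_eq_bot {Q : Fin 1 → MvPolynomial (Fin 1) K}
    (hQ : IsArtinianCIOfQuadrics Q) : gradedPiece (Ideal.span (Set.range Q)) 2 = ⊥ := by
  have hreg := hQ.isRegular.toIsWeaklyRegular
  have hlist : List.ofFn Q = [Q 0] := by simp [List.ofFn_succ]
  rw [hlist, RingTheory.Sequence.isWeaklyRegular_singleton_iff] at hreg
  have hQ0 : Q 0 ≠ 0 := fun h0 => by
    rw [h0] at hreg
    exact one_ne_zero (hreg (by simp) : (1 : MvPolynomial (Fin 1) K) = 0)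
  have hdim : finrank K (homogeneousSubmodule (Fin 1) K 2) ≤ 1 := by
    refine finrank_homogeneousSubmodule_le (ι := Unit)
      (fun _ => Finsupp.single 0 2) fun s hs => ⟨(), Finsupp.ext fun j => ?_⟩
    obtain rfl := Subsingleton.elim j 0
    simpa [Finsupp.degree_eq_sum] using hs.symm
  have : FiniteDimensional K (homogeneousSubmodule (Fin 1) K 2) :=
    Module.Finite.iff_fg.2 (homogeneousSubmodule_fg (Fin 1) K 2)
  have heq : K ∙ Q 0 = homogeneousSubmodule (Fin 1) K 2 := by
    refine Submodule.eq_of_le_of_finrank_le ?_ ?_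
    · rw [Submodule.span_singleton_le_iff_mem]
      exact hQ.isHomogeneous 0
    · rwa [finrank_span_singleton hQ0]
  rw [gradedPiece_eq_bot_iff]
  intro f hf
  obtain ⟨c, rfl⟩ : ∃ c : K, c • Q 0 = f := by
    rw [← Submodule.mem_span_singleton, heq]; exact hf
  rw [smul_eq_C_mul]
  exact Ideal.mul_mem_left _ _ (Ideal.subset_span ⟨0, rfl⟩)

/-- A socle degree at least three forces at least three variables. -/
theorem three_le_of_isSocleDegree {Q : Fin r → MvPolynomial (Fin r) K}
    (hQ : IsArtinianCIOfQuadrics Q) {e : ℕ}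
    (he : IsSocleDegree (Ideal.span (Set.range Q)) e) (he3 : 3 ≤ e) : 3 ≤ r := by
  by_contra! hr
  apply he.1
  interval_cases r
  · rw [gradedPiece_eq_bot_iff]
    intro f hf
    -- Without variables every polynomial is constant, hence homogeneous of degree 0.
    have hf0 : f = 0 := by
      by_contra hne
      have := hf.inj_right (isHomogeneous_of_isEmpty _ K f) hne
      omega
    rw [hf0]
    exact Ideal.zero_mem _
  · exact gradedPiece_eq_bot_of_le (by omega) (gradedPiece_two_eq_bot hQ)
  · exact gradedPiece_eq_bot_of_le he3 (gradedPiece_three_eq_bot hQ)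

end QuadricCI

theorem mainTheorem6 {K : Type*} [Field K] [CharZero K] {r : ℕ}
    (Q : Fin r → MvPolynomial (Fin r) K) (hQ : QuadricCI.IsArtinianCIOfQuadrics Q)
    (e : ℕ) (he : QuadricCI.IsSocleDegree (Ideal.span (Set.range Q)) e) (he3 : 3 ≤ e) :
    QuadricCI.ForGeneralLinearForm fun L : MvPolynomial.homogeneousSubmodule (Fin r) K 1 =>
      Function.Injective (QuadricCI.mulLinearForm (Ideal.span (Set.range Q)) L 1) := by
  have hr := QuadricCI.three_le_of_isSocleDegree hQ he he3
  let β := QuadricCI.mulForms (Ideal.span (Set.range Q))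
  by_cases h : ∃ a, Function.Injective (β a)
  · obtain ⟨a₀, ha₀⟩ := h
    obtain ⟨U, hU, hne, hinj⟩ := QuadricCI.exists_isZariskiOpen_injective β ha₀
    exact ⟨U, hU, hne, fun a ha =>
      QuadricCI.injective_mulLinearForm_of_injective_mulForms (hinj a ha)⟩
  · exfalso
    have hker (a : Fin r → K) : ∃ b ≠ 0, β a b = 0 := by
      have ha := not_exists.1 h a
      rw [injective_iff_map_eq_zero] at ha
      push Not at ha
      obtain ⟨b, hb, hb0⟩ := ha
      exact ⟨b, hb0, hb⟩
    have hsymm (a b : Fin r → K) : β a b = β b a := by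
      simp only [β, QuadricCI.mulForms_apply, mul_comm]
    obtain ⟨a, b, hli, hab, hv⟩ :=
      QuadricCI.exists_linearIndependent_pair_of_forall_exists_eq_zero β hsymm
        (by rw [Module.finrank_fin_fun]; omega) hker
    obtain ⟨p, hp, hap, hbp⟩ := QuadricCI.exists_common_zero hr a b
    have hQp (i : Fin r) : MvPolynomial.eval p (Q i) = 0 := by
      obtain ⟨v, w, hvw⟩ :=
        QuadricCI.exists_eq_mul_add_mul hQ.isHomogeneous hli hab hv i
      simp [hvw, QuadricCI.eval_linForm, hap, hbp]
    -- Degree `e + 1` is nonzero by the common zero, yet exceeds the socle degree.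
    have := he.2 (QuadricCI.gradedPiece_ne_bot_of_common_zero hp hQp (e + 1))
    omega
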